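/- Let $\mathbb{F}$ be an algebraically closed field of characteristic $0$ or $p>3$. A Lie algebra $\mathfrak{g}$ over $\mathbb{F}$ is called classical simple if it arises as follows: let $\mathfrak{g}_{\mathbb{C}}$ be a finite-dimensional simple complex Lie algebra with a Chevalley basis $\mathcal{C}$, let $\mathfrak{g}_{\mathbb{Z}}=\mathbb{Z}\,\mathcal{C}$ be its $\mathbb{Z}$-span, which is a Lie algebra over $\mathbb{Z}$, and let $\mathfrak{g}_{\mathbb{F}}=\mathfrak{g}_{\mathbb{Z}}\otimes_{\mathbb{Z}}\mathbb{F}$; then $\mathfrak{g}\cong\mathfrak{g}_{\mathbb{F}}/\mathfrak{z}(\mathfrak{g}_{\mathbb{F}})$. (The centre $\mathfrak{z}(\mathfrak{g}_{\mathbb{F}})$ is zero unless $\mathfrak{g}_{\mathbb{C}}$ has type $A_n$ and $p\mid n+1$, in which case $\mathfrak{g}\cong\mathfrak{psl}_{n+1}$.) A Lie algebra $\mathfrak{g}$ over $\mathbb{F}$ is said to be generated by one and a half elements if for every $x\in\mathfrak{g}\smallsetminus\{0\}$ there exists $y\in\mathfrak{g}$ such that the Lie subalgebra $\mathbb{F}\langle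 x,y\rangle$ generated by $x$ and $y$ is equal to $\mathfrak{g}$. Theorem. Every classical simple Lie algebra over $\mathbb{F}$ is generated by one and a half elements. In particular, if $\mathbb{F}$ has characteristic $0$, every finite-dimensional simple Lie algebra over $\mathbb{F}$ is generated by one and a half elements. -/

import Mathlib

open scoped TensorProduct

noncomputable section

/-- `L` is generated by one and a half elements: every nonzero `x` can be completed to a pair
`x, y` generating `L` as a Lie algebra over `F`. -/
def IsGeneratedByOneAndHalf (F L : Type*) [Field F] [LieRing L] [LieAlgebra F L] : Prop :=
  ∀ x : L, x ≠ 0 → ∃ y : L, LieSubalgebra.lieSpan F L {x, y} = ⊤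

section Chevalley

open LieAlgebra LieAlgebra.IsKilling LieModule

variable {L : Type*} [LieRing L] [LieAlgebra ℂ L] [FiniteDimensional ℂ L] [IsKilling ℂ L]
  (H : LieSubalgebra ℂ L) [H.IsCartanSubalgebra]

/-- A Chevalley basis of a complex semisimple Lie algebra `L` relative to a Cartan subalgebra `H`.
It consists of the simple coroots of a base of the root system, together with a root vector `e α`
for each root `α`, such that `⁅e α, e (-α)⁆` is the coroot of `α`, and such that
`⁅e α, e β⁆ = ± (r + 1) • e (α + β)` whenever `α`, `β`, `α + β` are roots, where `r` is the
largest integer such that `β - r α` is a root. -/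
structure ChevalleyBasis where
  base : (rootSystem H).Base
  e : H.root → L
  e_mem (α : H.root) : e α ∈ rootSpace H (α : Weight ℂ H L)
  lie_e_neg (α β : H.root) (h : (β : Weight ℂ H L) = -(α : Weight ℂ H L)) :
    ⁅e α, e β⁆ = ((coroot (α : Weight ℂ H L) : H) : L)
  lie_e_add (α β γ : H.root)
    (h : ((γ : Weight ℂ H L) : H → ℂ) = (α : Weight ℂ H L) + (β : Weight ℂ H L)) :
    ∃ ε : ℤ, (ε = 1 ∨ ε = -1) ∧
      ⁅e α, e β⁆ = (ε * (chainBotCoeff (α : Weight ℂ H L) (β : Weight ℂ H L) + 1)) • e γ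

namespace ChevalleyBasis

variable {H} (C : ChevalleyBasis H)

/-- The underlying set of a Chevalley basis: all `e α`, and the coroots of the simple roots. -/
def toSet : Set L :=
  Set.range C.e ∪ (fun α : H.root ↦ ((coroot (α : Weight ℂ H L) : H) : L)) '' C.base.support

lemma e_mem_span (α : H.root) : C.e α ∈ Submodule.span ℤ C.toSet :=
  Submodule.subset_span (Or.inl ⟨α, rfl⟩)

lemma coroot_mem_span (α : H.root) :
    ((coroot (α : Weight ℂ H L) : H) : L) ∈ Submodule.span ℤ C.toSet := by
  have h := C.base.coroot_mem_span_int α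
  have h2 := Submodule.mem_map_of_mem (f := H.toSubmodule.subtype.restrictScalars ℤ) h
  rw [Submodule.map_span] at h2
  refine Submodule.span_mono ?_ h2
  rintro _ ⟨_, ⟨β, hβ, rfl⟩, rfl⟩
  exact Or.inr ⟨β, hβ, rfl⟩

lemma lie_coroot_e_mem_span (α β : H.root) :
    ⁅((coroot (α : Weight ℂ H L) : H) : L), C.e β⁆ ∈ Submodule.span ℤ C.toSet := by
  have h : ⁅coroot (α : Weight ℂ H L), C.e β⁆ =
      (β : Weight ℂ H L) (coroot (α : Weight ℂ H L)) • C.e β :=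
    lie_eq_smul_of_mem_rootSpace (C.e_mem β) _
  rw [← LieSubalgebra.coe_bracket_of_module, h, apply_coroot_eq_cast, Int.cast_smul_eq_zsmul]
  exact Submodule.smul_mem _ _ (C.e_mem_span β)

lemma lie_e_e_mem_span (α β : H.root) :
    ⁅C.e α, C.e β⁆ ∈ Submodule.span ℤ C.toSet := by
  have hmem : ⁅C.e α, C.e β⁆ ∈ rootSpace H ((α : Weight ℂ H L) + (β : Weight ℂ H L) : H → ℂ) :=
    lie_mem_genWeightSpace_of_mem_genWeightSpace (C.e_mem α) (C.e_mem β)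
  by_cases hbot : rootSpace H ((α : Weight ℂ H L) + (β : Weight ℂ H L) : H → ℂ) = ⊥
  · rw [hbot, LieSubmodule.mem_bot] at hmem
    rw [hmem]
    exact zero_mem _
  · by_cases h0 : ((α : Weight ℂ H L) + (β : Weight ℂ H L) : H → ℂ) = 0
    · rw [C.lie_e_neg α β]
      · exact C.coroot_mem_span α
      · apply DFunLike.coe_injective
        rw [Weight.coe_neg]
        exact (neg_eq_of_add_eq_zero_right h0).symm
    · let γ : Weight ℂ H L := ⟨_, hbot⟩
      have hγ : γ ∈ H.root := by
        rw [LieSubalgebra.root, Finset.mem_filter]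
        exact ⟨Finset.mem_univ _, h0⟩
      obtain ⟨ε, -, hε⟩ := C.lie_e_add α β ⟨γ, hγ⟩ rfl
      rw [hε]
      exact Submodule.smul_mem _ _ (C.e_mem_span _)

/-- The `ℤ`-span of a Chevalley basis, as a Lie algebra over `ℤ`. -/
def integralForm : LieSubalgebra ℤ L where
  __ := Submodule.span ℤ C.toSet
  lie_mem' {x y} hx hy := by
    change ⁅x, y⁆ ∈ Submodule.span ℤ C.toSet
    change x ∈ Submodule.span ℤ C.toSet at hx
    change y ∈ Submodule.span ℤ C.toSet at hy
    induction hx, hy using Submodule.span_induction₂ with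
    | mem_mem x y hx hy =>
      rcases hx with ⟨α, rfl⟩ | ⟨α, -, rfl⟩ <;> rcases hy with ⟨β, rfl⟩ | ⟨β, -, rfl⟩
      · exact C.lie_e_e_mem_span α β
      · rw [← lie_skew]
        exact neg_mem (C.lie_coroot_e_mem_span β α)
      · exact C.lie_coroot_e_mem_span α β
      · have h : ⁅coroot (α : Weight ℂ H L), coroot (β : Weight ℂ H L)⁆ = 0 := trivial_lie_zero ..
        have h' : ⁅((coroot (α : Weight ℂ H L) : H) : L), ((coroot (β : Weight ℂ H L) : H) : L)⁆ =
            0 := congrArg (Subtype.val : H → L) h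
        simp only [h', zero_mem]
    | zero_left y hy => simp
    | zero_right x hx => simp
    | add_left x y z _ _ _ h₁ h₂ => rw [add_lie]; exact add_mem h₁ h₂
    | add_right x y z _ _ _ h₁ h₂ => rw [lie_add]; exact add_mem h₁ h₂
    | smul_left r x y _ _ h => rw [smul_lie]; exact Submodule.smul_mem _ _ h
    | smul_right r x y _ _ h => rw [lie_smul]; exact Submodule.smul_mem _ _ h

/-- The Lie algebra over `F` obtained from a Chevalley basis by extension of scalars from `ℤ`. -/
abbrev overField (F : Type*) [Field F] : Type _ := F ⊗[ℤ] C.integralForm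

end ChevalleyBasis

end Chevalley

/-- A Lie algebra `𝔤` over `F` is a classical simple Lie algebra if there are a finite-dimensional
simple complex Lie algebra `L` and a Chevalley basis `C` of `L` such that `𝔤` is isomorphic to the
quotient of `F ⊗ ℤC` by its centre. (In characteristic `0` or `p > 3` this centre is zero except
in type `A_n` with `p ∣ n + 1`.) -/
def IsClassicalSimple (F 𝔤 : Type*) [Field F] [LieRing 𝔤] [LieAlgebra F 𝔤] : Prop :=
  ∃ (L : Type) (_ : LieRing L) (_ : LieAlgebra ℂ L) (_ : FiniteDimensional ℂ L)
    (_ : LieAlgebra.IsSimple ℂ L) (H : LieSubalgebra ℂ L) (_ : H.IsCartanSubalgebra)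
    (C : ChevalleyBasis H),
    Nonempty (𝔤 ≃ₗ⁅F⁆ (C.overField F ⧸ LieAlgebra.center F (C.overField F)))

end

/-! Call the support of z the set of roots i with `coord i z ≠ 0`. If x has full support and a is a
regular element of the Cartan part, then x and a generate: polynomials in ad a extract every root
vector from x. So it suffices to move a noncentral x to full support by an automorphism.

Among the automorphic images of x choose one of maximal support S, and let T be the set of images
with support S. For z in T, exp(t ad e_i) z lies in T for all but finitely many t: a coordinate that
is nonzero at t = 0 is a nonzero cubic in t, and the support cannot grow beyond S. The linear term
[e_i, z] of this curve therefore lies in span T, which is thus a noncentral ideal and, the root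
system being connected, contains every e_i. Coordinates outside S vanish on span T, so S is
everything. This is `RootFrame.exists_lieSpan_eq_top`.

`ChevalleyBasis.nonempty_rootFrame` supplies the data after reduction mod p > 3: root strings have
length at most four, so the exponential is a cubic with denominators 2 and 6, and Cartan integers
are at most 3 in absolute value, so roots stay distinct and connected. -/

/-- A finite family of "root vectors" `e i` spanning, together with commuting "coroots" `h i`, a
Lie algebra, whose root strings have length at most four and whose roots `j ↦ c i j` are nonzero,
pairwise distinct and form a connected system. -/
structure RootFrame (F A ι : Type*) [Field F] [LieRing A] [LieAlgebra F A] where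
  e : ι → A
  f : ι → A
  h : ι → A
  c : ι → ι → F
  coord : ι → Module.Dual F A
  lie_h_e (i j : ι) : ⁅h j, e i⁆ = c i j • e i
  lie_h_h (i j : ι) : ⁅h i, h j⁆ = 0
  lie_e_f (i : ι) : ⁅e i, f i⁆ = h i
  f_mem (i : ι) : f i ∈ Submodule.span F (Set.range e)
  span_eq_top : Submodule.span F (Set.range e ∪ Set.range h) = ⊤
  coord_e_self (i : ι) : coord i (e i) = 1
  coord_e_of_ne (i j : ι) (hij : i ≠ j) : coord i (e j) = 0
  coord_h (i j : ι) : coord i (h j) = 0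
  exists_c_ne (i j : ι) (hij : i ≠ j) : ∃ k, c i k ≠ c j k
  exists_c_ne_zero (i : ι) : ∃ k, c i k ≠ 0
  connected (S : Set ι) (hS : S.Nonempty) (h : ∀ i ∈ S, ∀ j, c j i ≠ 0 → j ∈ S) : S = Set.univ
  lie_four (i : ι) (x : A) : ⁅e i, ⁅e i, ⁅e i, ⁅e i, x⁆⁆⁆⁆ = 0
  -- The last two identities follow from `lie_four` on division by 10; they are separate fields
  -- because characteristic 5 is allowed.
  lie_two_three (i : ι) (x y : A) :
    ⁅⁅e i, ⁅e i, x⁆⁆, ⁅e i, ⁅e i, ⁅e i, y⁆⁆⁆⁆ + ⁅⁅e i, ⁅e i, ⁅e i, x⁆⁆⁆, ⁅e i, ⁅e i, y⁆⁆⁆ = 0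
  lie_three_three (i : ι) (x y : A) :
    ⁅⁅e i, ⁅e i, ⁅e i, x⁆⁆⁆, ⁅e i, ⁅e i, ⁅e i, y⁆⁆⁆⁆ = 0

/-! ### Cubic curves in a vector space -/

section PolynomialCurves

variable {F V : Type*} [Field F] [AddCommGroup V] [Module F V]

open Polynomial in
lemma finite_setOf_cubic_eq_zero {a b c d : F} (h : ¬ (a = 0 ∧ b = 0 ∧ c = 0 ∧ d = 0)) :
    {t : F | a + t * b + t ^ 2 * c + t ^ 3 * d = 0}.Finite := by
  let p : F[X] := C a + X * C b + X ^ 2 * C c + X ^ 3 * C d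
  classical
  have hp : p ≠ 0 := by
    intro hp
    refine h ⟨?_, ?_, ?_, ?_⟩
    · simpa [p, coeff_X_pow_mul', coeff_C, coeff_X] using congrArg (coeff · 0) hp
    · simpa [p, coeff_X_pow_mul', coeff_C, coeff_X] using congrArg (coeff · 1) hp
    · simpa [p, coeff_X_pow_mul', coeff_C, coeff_X] using congrArg (coeff · 2) hp
    · simpa [p, coeff_X_pow_mul', coeff_C, coeff_X] using congrArg (coeff · 3) hp
  refine (p.roots.toFinset.finite_toSet).subset fun t ht ↦ ?_
  rw [SetLike.mem_coe, Multiset.mem_toFinset, mem_roots hp]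
  simp only [p, IsRoot.def, eval_add, eval_mul, eval_pow, eval_X, eval_C]
  exact ht

/-- Otherwise a functional killing `M` but not `v₁` turns the curve into a nonzero cubic with
infinitely many roots. -/
lemma mem_of_infinite_cubic_mem {M : Submodule F V} {v₀ v₁ v₂ v₃ : V}
    (h : {t : F | v₀ + t • v₁ + t ^ 2 • v₂ + t ^ 3 • v₃ ∈ M}.Infinite) : v₁ ∈ M := by
  by_contra hv
  obtain ⟨g, hg, hM⟩ := Submodule.exists_le_ker_of_notMem hv
  refine h ((finite_setOf_cubic_eq_zero (a := g v₀) (b := g v₁) (c := g v₂) (d := g v₃)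
    (fun H ↦ hg H.2.1)).subset fun t ht ↦ ?_)
  simpa using hM ht

end PolynomialCurves

/-! ### The truncated exponential as an automorphism -/

section TruncatedExponential

variable {F A : Type*} [Field F] [LieRing A] [LieAlgebra F A]

/-- The truncated exponential series `1 + t D + t² D² / 2 + t³ D³ / 6` of `D = ad e`. -/
noncomputable def expAd (e : A) (t : F) : A →ₗ[F] A :=
  LinearMap.id + t • LieAlgebra.ad F A e + (t ^ 2 * 2⁻¹) • (LieAlgebra.ad F A e) ^ 2 +
    (t ^ 3 * 6⁻¹) • (LieAlgebra.ad F A e) ^ 3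

lemma expAd_apply (e : A) (t : F) (x : A) :
    expAd e t x = x + t • ⁅e, x⁆ + t ^ 2 • ((2⁻¹ : F) • ⁅e, ⁅e, x⁆⁆) +
      t ^ 3 • ((6⁻¹ : F) • ⁅e, ⁅e, ⁅e, x⁆⁆⁆) := by
  simp [expAd, pow_succ, smul_smul]

variable {e : A} (h6 : (6 : F) ≠ 0) (h4 : ∀ x : A, ⁅e, ⁅e, ⁅e, ⁅e, x⁆⁆⁆⁆ = 0)
include h6 h4

lemma expAd_expAd_neg (t : F) (x : A) : expAd e t (expAd e (-t) x) = x := by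
  have h2 : (2 : F) ≠ 0 := fun h ↦ h6 (by linear_combination 3 * h)
  simp only [expAd_apply, lie_add, lie_smul, h4, smul_zero, add_zero]
  match_scalars <;> field_simp <;> ring

/-- The two sides can differ only in degrees 4, 5 and 6 in t. Degree 4 is the Leibniz expansion of
D⁴[x, y] = 0 divided by 24; degrees 5 and 6 are `h5` and `h33`. -/
lemma expAd_lie
    (h5 : ∀ x y : A, ⁅⁅e, ⁅e, x⁆⁆, ⁅e, ⁅e, ⁅e, y⁆⁆⁆⁆ + ⁅⁅e, ⁅e, ⁅e, x⁆⁆⁆, ⁅e, ⁅e, y⁆⁆⁆ = 0)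
    (h33 : ∀ x y : A, ⁅⁅e, ⁅e, ⁅e, x⁆⁆⁆, ⁅e, ⁅e, ⁅e, y⁆⁆⁆⁆ = 0) (t : F) (x y : A) :
    expAd e t ⁅x, y⁆ = ⁅expAd e t x, expAd e t y⁆ := by
  have h2 : (2 : F) ≠ 0 := fun h ↦ h6 (by linear_combination 3 * h)
  obtain ⟨D, hD⟩ : ∃ D : A →ₗ[F] A, ∀ x, ⁅e, x⁆ = D x := ⟨LieAlgebra.ad F A e, fun _ ↦ rfl⟩
  have hL (x y : A) : D ⁅x, y⁆ = ⁅D x, y⁆ + ⁅x, D y⁆ := by rw [← hD, leibniz_lie, hD, hD]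
  simp only [hD] at h4 h5 h33
  have h4' := h4 ⁅x, y⁆
  simp only [hL, map_add, h4, zero_lie, lie_zero, zero_add, add_zero] at h4'
  have h4'' : (4 : F) • ⁅D (D (D x)), D y⁆ + (6 : F) • ⁅D (D x), D (D y)⁆ +
      (4 : F) • ⁅D x, D (D (D y))⁆ = 0 := by
    rw [← h4']; module
  simp only [expAd_apply, hD, hL, map_add, lie_add, add_lie, lie_smul, smul_lie, smul_add]
  have h44 := congrArg (fun z ↦ (t ^ 4 * (6 : F)⁻¹ * (2 : F)⁻¹ * (2 : F)⁻¹) • z) h4''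
  have h55 := congrArg (fun z ↦ (t ^ 5 * (2 : F)⁻¹ * (6 : F)⁻¹) • z) (h5 x y)
  have h66 := congrArg (fun z ↦ (t ^ 6 * (6 : F)⁻¹ * (6 : F)⁻¹) • z) (h33 x y)
  linear_combination (norm := skip) -h44 - h55 - h66
  match_scalars <;> field_simp <;> ring

end TruncatedExponential

/-! ### Generating pairs from a root frame -/

namespace RootFrame

variable {F A ι : Type*} [Field F] [LieRing A] [LieAlgebra F A] (R : RootFrame F A ι)

lemma induction_on {p : A → Prop} (x : A) (he : ∀ i, p (R.e i)) (hh : ∀ i, p (R.h i)) (h0 : p 0)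
    (hadd : ∀ x y, p x → p y → p (x + y)) (hsmul : ∀ (a : F) x, p x → p (a • x)) : p x := by
  have hx : x ∈ Submodule.span F (Set.range R.e ∪ Set.range R.h) := R.span_eq_top ▸ trivial
  induction hx using Submodule.span_induction with
  | mem x hx => rcases hx with ⟨i, rfl⟩ | ⟨i, rfl⟩ <;> simp_all
  | zero => exact h0
  | add x y _ _ hx hy => exact hadd x y hx hy
  | smul a x _ hx => exact hsmul a x hx

/-- The exponential of a multiple of a root vector, as an automorphism. -/
noncomputable def expEquiv (h6 : (6 : F) ≠ 0) (i : ι) (t : F) : A ≃ₗ⁅F⁆ A where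
  toFun := expAd (R.e i) t
  invFun := expAd (R.e i) (-t)
  map_add' := map_add _
  map_smul' := map_smul _
  map_lie' {x y} := expAd_lie h6 (R.lie_four i) (R.lie_two_three i) (R.lie_three_three i) t x y
  left_inv x := by simpa using expAd_expAd_neg h6 (R.lie_four i) (-t) x
  right_inv x := expAd_expAd_neg h6 (R.lie_four i) t x

lemma expEquiv_apply (h6 : (6 : F) ≠ 0) (i : ι) (t : F) (x : A) :
    R.expEquiv h6 i t x = x + t • ⁅R.e i, x⁆ + t ^ 2 • ((2⁻¹ : F) • ⁅R.e i, ⁅R.e i, x⁆⁆) +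
      t ^ 3 • ((6⁻¹ : F) • ⁅R.e i, ⁅R.e i, ⁅R.e i, x⁆⁆⁆) :=
  expAd_apply _ _ _

/-- An element of the Cartan part on which the roots take distinct nonzero values. -/
structure IsRegular (a : A) (w : ι → F) : Prop where
  lie_e (i : ι) : ⁅a, R.e i⁆ = w i • R.e i
  lie_h (i : ι) : ⁅a, R.h i⁆ = 0
  injective : Function.Injective w
  ne_zero (i : ι) : w i ≠ 0

/-- The roots and their differences are finitely many nonzero linear forms in the coefficients of ∑
t_k h_k; over an infinite field they have a common point of nonvanishing. -/
lemma exists_isRegular [Infinite F] [Finite ι] : ∃ a w, R.IsRegular a w := by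
  have := Fintype.ofFinite ι
  let g : ι ⊕ {q : ι × ι // q.1 ≠ q.2} → Module.Dual F (ι → F) :=
    Sum.elim (fun i ↦ ∑ k, R.c i k • LinearMap.proj k)
      (fun q ↦ ∑ k, (R.c q.1.1 k - R.c q.1.2 k) • LinearMap.proj k)
  have hg : ∀ s, ∃ t, g s t ≠ 0 := by
    classical
    rintro (i | ⟨⟨i, j⟩, hij⟩)
    · obtain ⟨k, hk⟩ := R.exists_c_ne_zero i
      exact ⟨Pi.single k 1, by simpa [g, Pi.single_apply] using hk⟩
    · obtain ⟨k, hk⟩ := R.exists_c_ne i j hij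
      exact ⟨Pi.single k 1, by simpa [g, Pi.single_apply, sub_eq_zero] using hk⟩
  obtain ⟨t, ht⟩ := Module.Dual.exists_forall_ne_zero_of_forall_exists g hg
  refine ⟨∑ k, t k • R.h k, fun i ↦ ∑ k, R.c i k * t k, fun i ↦ ?_, fun i ↦ ?_, fun i j hij ↦ ?_,
    fun i ↦ ?_⟩
  · simp [sum_lie, R.lie_h_e, Finset.sum_smul, smul_smul, mul_comm]
  · simp [sum_lie, R.lie_h_h]
  · by_contra hne
    refine ht (Sum.inr ⟨⟨i, j⟩, hne⟩) ?_
    simpa [g, sub_mul, sub_eq_zero] using hij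
  · simpa [g] using ht (Sum.inl i)

variable {R}

open Polynomial in
-- Interpolation: p = X ∏_{j ≠ i} (X - w_j) evaluated at ad a kills the Cartan part and every root
-- vector except `R.e i`.
lemma IsRegular.coord_smul_mem [Finite ι] {a : A} {w : ι → F} (ha : R.IsRegular a w)
    {M : Submodule F A} (hM : ∀ x ∈ M, ⁅a, x⁆ ∈ M) {x : A} (hx : x ∈ M) (i : ι) :
    R.coord i x • R.e i ∈ M := by
  classical
  have := Fintype.ofFinite ι
  let p : F[X] := X * ∏ j ∈ Finset.univ.erase i, (X - C (w j))
  have hp (j : ι) (hj : j ≠ i) : p.eval (w j) = 0 := by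
    simp only [p, eval_mul, eval_prod]
    rw [Finset.prod_eq_zero (i := j) (by simpa using hj) (by simp), mul_zero]
  have hpi : p.eval (w i) ≠ 0 := by
    simp only [p, eval_mul, eval_prod, eval_X, mul_ne_zero_iff, Finset.prod_ne_zero_iff]
    refine ⟨ha.ne_zero i, fun j hj ↦ ?_⟩
    simpa [sub_eq_zero] using fun h ↦ (Finset.ne_of_mem_erase hj) (ha.injective h.symm)
  have key (y : A) : aeval (LieAlgebra.ad F A a) p y = p.eval (w i) • R.coord i y • R.e i := by
    induction y using R.induction_on with
    | he j =>
      rw [Module.End.aeval_apply_of_mem_apply_eq_smul (μ := w j) (by simp [ha.lie_e])]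
      rcases eq_or_ne j i with rfl | hj
      · simp [R.coord_e_self]
      · simp [hp j hj, R.coord_e_of_ne i j hj.symm]
    | hh j =>
      rw [Module.End.aeval_apply_of_mem_apply_eq_smul (μ := 0) (by simp [ha.lie_h])]
      simp [p, R.coord_h]
    | h0 => simp
    | hadd x y hx hy => simp only [map_add, hx, hy]; module
    | hsmul b x hx => simp only [map_smul, hx, smul_eq_mul]; module
  have hmem : aeval (LieAlgebra.ad F A a) p x ∈ M := by
    have h (q : F[X]) : ∀ y ∈ M, aeval (LieAlgebra.ad F A a) q y ∈ M := by
      induction q using Polynomial.induction_on' with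
      | add q r hq hr => intro y hy; simpa using M.add_mem (hq y hy) (hr y hy)
      | monomial n b =>
        intro y hy
        rw [aeval_monomial, Module.End.mul_apply, Module.algebraMap_end_apply]
        refine M.smul_mem _ ?_
        induction n with
        | zero => simpa
        | succ n ih => rw [pow_succ']; exact hM _ ih
    exact h p x hx
  rw [key] at hmem
  exact (M.smul_mem_iff hpi).1 hmem

lemma lie_mem_of_forall_lie_e_mem {M : Submodule F A} (hM : ∀ i, ∀ x ∈ M, ⁅R.e i, x⁆ ∈ M)
    (a : A) {x : A} (hx : x ∈ M) : ⁅a, x⁆ ∈ M := by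
  have hspan (b : A) (hb : b ∈ Submodule.span F (Set.range R.e)) (x : A) (hx : x ∈ M) :
      ⁅b, x⁆ ∈ M := by
    induction hb using Submodule.span_induction with
    | mem b hb => obtain ⟨i, rfl⟩ := hb; exact hM i x hx
    | zero => simp
    | add b c _ _ hb hc => rw [add_lie]; exact M.add_mem hb hc
    | smul r b _ hb => rw [smul_lie]; exact M.smul_mem _ hb
  induction a using R.induction_on with
  | he i => exact hM i x hx
  -- ad h_i is the commutator of ad e_i and ad f_i, and f_i is a combination of root vectors.
  | hh i =>
    rw [← R.lie_e_f, lie_lie]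
    exact M.sub_mem (hM i _ (hspan _ (R.f_mem i) x hx)) (hspan _ (R.f_mem i) _ (hM i x hx))
  | h0 => simp
  | hadd b c hb hc => rw [add_lie]; exact M.add_mem hb hc
  | hsmul r b hb => rw [smul_lie]; exact M.smul_mem _ hb

/-- An invariant submodule that is not contained in the centre contains all root vectors. -/
lemma e_mem_of_forall_lie_e_mem [Infinite F] [Finite ι] {M : Submodule F A}
    (hM : ∀ i, ∀ x ∈ M, ⁅R.e i, x⁆ ∈ M) {x : A} (hx : x ∈ M) (hx' : ∃ y : A, ⁅y, x⁆ ≠ 0) (i : ι) :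
    R.e i ∈ M := by
  have hlie (a x : A) (hx : x ∈ M) : ⁅a, x⁆ ∈ M := lie_mem_of_forall_lie_e_mem hM a hx
  obtain ⟨a, w, ha⟩ := R.exists_isRegular
  have hne : ∃ i, R.e i ∈ M := by
    have hcoord (y : A) (hy : y ∈ M) (i : ι) (hi : R.coord i y ≠ 0) : R.e i ∈ M :=
      (M.smul_mem_iff hi).1 (ha.coord_smul_mem (fun x hx ↦ hlie a x hx) hy i)
    -- If `M` contained no root vector, all coordinates would vanish on `M`. Then x lies in the
    -- Cartan part, and [x, e_j] = r e_j in `M` forces r = 0, so x is central.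
    by_contra! hcon
    have hzero (y : A) (hy : y ∈ M) (i : ι) : R.coord i y = 0 := by
      by_contra h
      exact hcon i (hcoord y hy i h)
    have hdecomp (y : A) : y - ∑ᶠ i, R.coord i y • R.e i ∈ Submodule.span F (Set.range R.h) := by
      have := Fintype.ofFinite ι
      rw [finsum_eq_sum_of_fintype]
      induction y using R.induction_on with
      | he j =>
        rw [Finset.sum_eq_single j (fun b _ hb ↦ by rw [R.coord_e_of_ne b j hb, zero_smul])
          (by simp), R.coord_e_self, one_smul, sub_self]
        exact zero_mem _
      | hh j => simpa [R.coord_h] using Submodule.subset_span (Set.mem_range_self j)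
      | h0 => simp
      | hadd x y hx hy =>
        convert add_mem hx hy using 1
        simp only [map_add, add_smul, Finset.sum_add_distrib]
        abel
      | hsmul b x hx =>
        convert Submodule.smul_mem _ b hx using 1
        simp only [map_smul, smul_sub, Finset.smul_sum, smul_smul, smul_eq_mul]
    have hxh : x ∈ Submodule.span F (Set.range R.h) := by
      simpa [hzero x hx] using hdecomp x
    have hxhh (j : ι) : ⁅x, R.h j⁆ = 0 := by
      clear hx' hx
      induction hxh using Submodule.span_induction with
      | mem b hb => obtain ⟨i, rfl⟩ := hb; exact R.lie_h_h i j
      | zero => simp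
      | add b c _ _ hb hc => rw [add_lie, hb, hc, add_zero]
      | smul r b _ hb => rw [smul_lie, hb, smul_zero]
    have hxe (j : ι) : ∃ r : F, ⁅x, R.e j⁆ = r • R.e j := by
      clear hx' hx hxhh
      induction hxh using Submodule.span_induction with
      | mem b hb => obtain ⟨i, rfl⟩ := hb; exact ⟨_, R.lie_h_e j i⟩
      | zero => exact ⟨0, by simp⟩
      | add b c _ _ hb hc =>
        obtain ⟨r, hr⟩ := hb
        obtain ⟨s, hs⟩ := hc
        exact ⟨r + s, by rw [add_lie, hr, hs, add_smul]⟩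
      | smul r b _ hb =>
        obtain ⟨s, hs⟩ := hb
        exact ⟨r * s, by rw [smul_lie, hs, smul_smul]⟩
    obtain ⟨y, hy⟩ := hx'
    refine hy ?_
    clear hy
    rw [← lie_skew, neg_eq_zero]
    induction y using R.induction_on with
    | he j =>
      obtain ⟨r, hr⟩ := hxe j
      have h1 : ⁅x, R.e j⁆ ∈ M := by rw [← lie_skew]; exact M.neg_mem (hlie _ _ hx)
      have h2 := hzero _ h1 j
      rw [hr, map_smul, R.coord_e_self, smul_eq_mul, mul_one] at h2
      rw [hr, h2, zero_smul]
    | hh j => exact hxhh j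
    | h0 => simp
    | hadd b c hb hc => rw [lie_add, hb, hc, add_zero]
    | hsmul r b hb => rw [lie_smul, hb, smul_zero]
  -- From e_i in `M` one gets h_i = [e_i, f_i] in `M`, hence every e_j with `c j i ≠ 0`.
  have hS := R.connected {i | R.e i ∈ M} hne fun i hi j hij ↦ by
    have hh : R.h i ∈ M := by
      rw [← R.lie_e_f, ← lie_skew]
      exact M.neg_mem (hlie _ _ hi)
    have h1 : ⁅R.h i, R.e j⁆ ∈ M := by
      rw [← lie_skew]
      exact M.neg_mem (hlie _ _ hh)
    rw [R.lie_h_e] at h1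
    exact (M.smul_mem_iff hij).1 h1
  exact Set.eq_univ_iff_forall.1 hS i

lemma IsRegular.lieSpan_eq_top [Finite ι] {a : A} {w : ι → F} (ha : R.IsRegular a w) {x : A}
    (hx : ∀ i, R.coord i x ≠ 0) : LieSubalgebra.lieSpan F A {x, a} = ⊤ := by
  set K := LieSubalgebra.lieSpan F A {x, a}
  have hxK : x ∈ K := LieSubalgebra.subset_lieSpan (by simp)
  have haK : a ∈ K := LieSubalgebra.subset_lieSpan (by simp)
  have he (i : ι) : R.e i ∈ K.toSubmodule :=
    (Submodule.smul_mem_iff _ (hx i)).1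
      (ha.coord_smul_mem (M := K.toSubmodule) (fun y hy ↦ K.lie_mem haK hy) hxK i)
  have hf (i : ι) : R.f i ∈ K.toSubmodule := by
    refine Submodule.span_le.2 ?_ (R.f_mem i)
    rintro _ ⟨j, rfl⟩
    exact he j
  rw [← LieSubalgebra.toSubmodule_inj, LieSubalgebra.top_toSubmodule, ← top_le_iff,
    ← R.span_eq_top, Submodule.span_le]
  rintro _ (⟨i, rfl⟩ | ⟨i, rfl⟩)
  · exact he i
  · rw [← R.lie_e_f]
    exact K.lie_mem (he i) (hf i)

/-- Every noncentral element of a Lie algebra with a root frame is part of a generating pair. -/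
theorem exists_lieSpan_eq_top [Infinite F] [Finite ι] (R : RootFrame F A ι) (h6 : (6 : F) ≠ 0)
    {x : A} (hx : ∃ y : A, ⁅y, x⁆ ≠ 0) : ∃ y, LieSubalgebra.lieSpan F A {x, y} = ⊤ := by
  let supp (z : A) : Set ι := {i | R.coord i z ≠ 0}
  obtain ⟨_, ⟨σ, rfl⟩, hσ⟩ :=
    (Set.toFinite (Set.range fun σ : A ≃ₗ⁅F⁆ A ↦ supp (σ x))).exists_maximal
    ⟨_, Set.mem_range_self LieEquiv.refl⟩
  set S := supp (σ x)
  let T : Set A := {z | supp z = S ∧ ∃ τ : A ≃ₗ⁅F⁆ A, z = τ x}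
  have hfin (z : A) (hz : z ∈ T) (i : ι) : {t : F | R.expEquiv h6 i t z ∉ T}.Finite := by
    obtain ⟨hzS, τ, rfl⟩ := hz
    refine ((Set.toFinite S).biUnion (t := fun j ↦ {t | R.coord j (R.expEquiv h6 i t (τ x)) = 0})
      fun j hj ↦ ?_).subset fun t ht ↦ ?_
    -- The constant term of this cubic in t is coordinate j of τ x, nonzero since j ∈ S.
    · simp only [expEquiv_apply, map_add, map_smul _ (_ ^ 2) (_ • _), map_smul _ (_ ^ 3) (_ • _),
        map_smul _ _ ⁅_, _⁆, smul_eq_mul]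
      refine finite_setOf_cubic_eq_zero fun h ↦ ?_
      rw [← hzS] at hj
      exact hj h.1
    · by_contra hcon
      simp only [Set.mem_iUnion, Set.mem_ofPred_eq, not_exists] at hcon
      have hle : S ⊆ supp (R.expEquiv h6 i t (τ x)) := hcon
      refine ht ⟨le_antisymm (hσ ⟨τ.trans (R.expEquiv h6 i t), rfl⟩ hle) hle,
        τ.trans (R.expEquiv h6 i t), rfl⟩
  have hM : ∀ i, ∀ z ∈ Submodule.span F T, ⁅R.e i, z⁆ ∈ Submodule.span F T := by
    intro i z hz
    induction hz using Submodule.span_induction with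
    | mem z hz =>
      have hinf := (hfin z hz i).infinite_compl
      refine mem_of_infinite_cubic_mem (v₀ := z) (v₂ := (2⁻¹ : F) • ⁅R.e i, ⁅R.e i, z⁆⁆)
        (v₃ := (6⁻¹ : F) • ⁅R.e i, ⁅R.e i, ⁅R.e i, z⁆⁆⁆) (hinf.mono fun t ht ↦ ?_)
      have h := Submodule.subset_span (R := F) (not_not.1 ht)
      rwa [SetLike.mem_coe, expEquiv_apply] at h
    | zero => simp
    | add y z _ _ hy hz => rw [lie_add]; exact add_mem hy hz
    | smul r z _ hz => rw [lie_smul]; exact Submodule.smul_mem _ _ hz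
  have hmem : σ x ∈ Submodule.span F T := Submodule.subset_span ⟨rfl, σ, rfl⟩
  have hne : ∃ y : A, ⁅y, σ x⁆ ≠ 0 := by
    obtain ⟨y, hy⟩ := hx
    refine ⟨σ y, ?_⟩
    rw [← LieEquiv.map_lie]
    exact fun h ↦ hy (σ.injective (h.trans (map_zero σ.toLinearEquiv).symm))
  have hall (i : ι) : R.coord i (σ x) ≠ 0 := by
    intro hi
    -- All elements of `T` have support exactly S, so a coordinate outside S kills their span.
    have hker : Submodule.span F T ≤ LinearMap.ker (R.coord i) := by
      refine Submodule.span_le.2 fun z hz ↦ ?_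
      by_contra h
      have : i ∈ supp z := h
      rw [hz.1] at this
      exact this hi
    have h1 := hker (e_mem_of_forall_lie_e_mem hM hmem hne i)
    rw [LinearMap.mem_ker, R.coord_e_self] at h1
    exact one_ne_zero h1
  obtain ⟨a, w, ha⟩ := R.exists_isRegular
  refine ⟨σ.symm a, ?_⟩
  have h := congrArg (LieSubalgebra.map σ.symm.toLieHom) (ha.lieSpan_eq_top hall)
  rw [LieSubalgebra.map_lieSpan, Set.image_pair] at h
  rw [← LieHom.range_eq_map, (LieHom.range_eq_top _).2 σ.symm.surjective] at h
  simpa using h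

end RootFrame

/-! ### Identities for (ad e)⁴ = 0 without torsion -/

section NilpotentOfIndexFour

variable {L : Type*} [LieRing L] [IsAddTorsionFree L] {e : L}
  (h4 : ∀ x : L, ⁅e, ⁅e, ⁅e, ⁅e, x⁆⁆⁆⁆ = 0)
include h4

lemma lie_lie_lie_lie_add_eq_zero (x y : L) :
    ⁅⁅e, ⁅e, x⁆⁆, ⁅e, ⁅e, ⁅e, y⁆⁆⁆⁆ + ⁅⁅e, ⁅e, ⁅e, x⁆⁆⁆, ⁅e, ⁅e, y⁆⁆⁆ = 0 := by
  obtain ⟨D, hD⟩ : ∃ D : L →+ L, ∀ x, ⁅e, x⁆ = D x :=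
    ⟨AddMonoidHom.mk' (fun x ↦ ⁅e, x⁆) (lie_add e), fun _ ↦ rfl⟩
  have hL (x y : L) : D ⁅x, y⁆ = ⁅D x, y⁆ + ⁅x, D y⁆ := by rw [← hD, leibniz_lie, hD, hD]
  simp only [hD] at h4 ⊢
  have h5 := congrArg D (h4 ⁅x, y⁆)
  simp only [hL, map_add, h4, zero_lie, lie_zero, zero_add, add_zero, map_zero] at h5
  -- The Leibniz expansion of D⁵[x, y] has both binomial coefficients equal to 10.
  refine (nsmul_eq_zero_iff_right (n := 10) (by norm_num)).1 ?_
  rw [← h5]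
  abel

lemma lie_lie_lie_lie_eq_zero (x y : L) :
    ⁅⁅e, ⁅e, ⁅e, x⁆⁆⁆, ⁅e, ⁅e, ⁅e, y⁆⁆⁆⁆ = 0 := by
  have h5 := lie_lie_lie_lie_add_eq_zero h4 x ⁅e, y⁆
  rw [h4, lie_zero, zero_add] at h5
  exact h5

end NilpotentOfIndexFour

/-! ### Cartan integers, root strings and coordinates -/

namespace LieAlgebra.IsKilling

open LieModule Module

variable {K L : Type*} [Field K] [CharZero K] [LieRing L] [LieAlgebra K L]
  [IsKilling K L] [FiniteDimensional K L]
  {H : LieSubalgebra K L} [H.IsCartanSubalgebra] [IsTriangularizable K H L]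

variable (H) in
/-- The Cartan integer `α (coroot β)`. -/
noncomputable def cartanInt (α β : H.root) : ℤ :=
  chainBotCoeff (β : Weight K H L) (α : Weight K H L) -
    chainTopCoeff (β : Weight K H L) (α : Weight K H L)

lemma cast_cartanInt (α β : H.root) :
    (cartanInt H α β : K) = (α : Weight K H L) (coroot (β : Weight K H L)) :=
  (apply_coroot_eq_cast _ _).symm

lemma pairingIn_eq_cartanInt (α β : H.root) :
    (rootSystem H).pairingIn ℤ α β = cartanInt H α β := by
  apply Int.cast_injective (α := K)
  rw [cast_cartanInt, ← rootSystem_pairing_apply, ← (rootSystem H).algebraMap_pairingIn ℤ]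
  rfl

lemma cartanInt_mem (α β : H.root) : (cartanInt H α β, cartanInt H β α) ∈
    ({(0, 0), (1, 1), (-1, -1), (1, 2), (2, 1), (-1, -2), (-2, -1), (1, 3), (3, 1), (-1, -3),
      (-3, -1), (2, 2), (-2, -2)} : Set (ℤ × ℤ)) := by
  simp only [← pairingIn_eq_cartanInt]
  exact (rootSystem H).pairingIn_pairingIn_mem_set_of_isCrystal_of_isRed α β

lemma cartanInt_self (α : H.root) : cartanInt H α α = 2 := by
  rw [← pairingIn_eq_cartanInt, RootPairing.pairingIn_same]

lemma cartanInt_eq_zero_comm (α β : H.root) : cartanInt H α β = 0 ↔ cartanInt H β α = 0 := by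
  have := cartanInt_mem α β
  simp only [Set.mem_insert_iff, Set.mem_singleton_iff, Prod.mk.injEq] at this
  omega

/-- One of α, β is a witness. For β ≠ -α some Cartan integer of the pair is 0, 1 or -1, and its
difference from 2 is 2, 1 or 3; for β = -α the difference is 4. -/
lemma exists_cartanInt_cast_ne {F : Type*} [Field F] (h2 : (2 : F) ≠ 0) (h3 : (3 : F) ≠ 0)
    (α β : H.root) (hαβ : α ≠ β) : ∃ γ, (cartanInt H α γ : F) ≠ cartanInt H β γ := by
  by_contra! hcon
  have hα := hcon α
  have hβ := hcon β
  rw [cartanInt_self] at hα hβ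
  have h1 : (1 : F) ≠ 0 := one_ne_zero
  have h4 : (4 : F) ≠ 0 := fun h ↦ h2 (pow_eq_zero_iff two_ne_zero |>.1 (by linear_combination h))
  by_cases hneg : (rootSystem H).root α = -(rootSystem H).root β
  · have h : cartanInt H α β = -2 := by
      rw [← pairingIn_eq_cartanInt]
      apply Int.cast_injective (α := K)
      have := (rootSystem H).algebraMap_pairingIn ℤ α β
      rw [algebraMap_int_eq, eq_intCast] at this
      rw [this, RootPairing.pairing, RootPairing.root', hneg]
      simp [root_apply_coroot (H.isNonZero_coe_root β)]
    rw [h] at hβ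
    push_cast at hβ
    exact h4 (by linear_combination -hβ)
  · have hmem := (rootSystem H).pairingIn_pairingIn_mem_set_of_isCrystal_of_isRed' α β
      (fun h ↦ hαβ ((rootSystem H).root.injective h)) hneg
    rw [pairingIn_eq_cartanInt, pairingIn_eq_cartanInt] at hmem
    simp only [Set.mem_insert_iff, Set.mem_singleton_iff, Prod.mk.injEq] at hmem
    rcases hmem with h | h | h | h | h | h | h | h | h | h | h <;> rw [h.2] at hα <;>
      rw [h.1] at hβ <;> push_cast at hα hβ <;>
    first
    | exact h1 (by linear_combination hα)
    | exact h1 (by linear_combination -hα)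
    | exact h1 (by linear_combination hβ)
    | exact h1 (by linear_combination -hβ)
    | exact h2 (by linear_combination hα)
    | exact h3 (by linear_combination hα)
    | exact h3 (by linear_combination -hβ)

lemma cartanInt_cast_ne_zero {F : Type*} [Field F] (h2 : (2 : F) ≠ 0) (h3 : (3 : F) ≠ 0)
    {α β : H.root} (h : cartanInt H α β ≠ 0) : (cartanInt H α β : F) ≠ 0 := by
  have hmem := cartanInt_mem α β
  simp only [Set.mem_insert_iff, Set.mem_singleton_iff, Prod.mk.injEq] at hmem
  have hcases : cartanInt H α β = 1 ∨ cartanInt H α β = -1 ∨ cartanInt H α β = 2 ∨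
    cartanInt H α β = -2 ∨ cartanInt H α β = 3 ∨ cartanInt H α β = -3 := by omega
  rcases hcases with h | h | h | h | h | h <;> rw [h] <;> simp [h2, h3]

/-- By irreducibility S spans. A root β outside S is orthogonal to S, so its coroot would kill
everything, including β itself. -/
lemma eq_univ_of_forall_cartanInt_ne_zero [(rootSystem H).IsIrreducible] (S : Set H.root)
    (hS : S.Nonempty) (h : ∀ α ∈ S, ∀ β, cartanInt H β α ≠ 0 → β ∈ S) : S = Set.univ := by
  have hpair (α β : H.root) : (rootSystem H).pairing α β = cartanInt H α β := by
    rw [cast_cartanInt, rootSystem_pairing_apply]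
  have hspan : Submodule.span K ((rootSystem H).root '' S) = ⊤ := by
    refine (rootSystem H).span_root_image_eq_top_of_forall_orthogonal S hS fun β hβ α hα ↦ ?_
    have h0 : cartanInt H β α = 0 := by
      by_contra hne
      exact hβ (Submodule.subset_span ⟨β, h α hα β hne, rfl⟩)
    exact ⟨by rw [hpair, h0, Int.cast_zero],
      by rw [hpair, (cartanInt_eq_zero_comm β α).1 h0, Int.cast_zero]⟩
  refine Set.eq_univ_iff_forall.2 fun β ↦ ?_
  by_contra hβ
  have hle : Submodule.span K ((rootSystem H).root '' S) ≤
      LinearMap.ker ((rootSystem H).coroot' β) := by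
    rw [Submodule.span_le]
    rintro _ ⟨α, hα, rfl⟩
    have h0 : cartanInt H α β = 0 := by
      rw [cartanInt_eq_zero_comm]
      by_contra hne
      exact hβ (h α hα β hne)
    rw [SetLike.mem_coe, LinearMap.mem_ker, RootPairing.root_coroot'_eq_pairing, hpair, h0,
      Int.cast_zero]
  have h1 : (rootSystem H).root β ∈ LinearMap.ker ((rootSystem H).coroot' β) :=
    hle (hspan ▸ Submodule.mem_top)
  rw [LinearMap.mem_ker, RootPairing.root_coroot'_eq_pairing, RootPairing.pairing_same] at h1
  exact two_ne_zero h1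

/-- The Cartan integer of the top of the string against α is the sum of the two chain coefficients,
and Cartan integers are at most 3. -/
lemma chainTopCoeff_le_three (α : H.root) (β : Weight K H L) :
    chainTopCoeff (α : Weight K H L) β ≤ 3 := by
  have hα := H.isNonZero_coe_root α
  have h0 := chainTop_isNonZero (α : Weight K H L) β hα
  have hmem := cartanInt_mem ⟨chainTop (α : Weight K H L) β, by simpa using h0⟩ α
  have htop := chainTopCoeff_of_eq_zsmul_add (α : Weight K H L) β hα
    (chainTop (α : Weight K H L) β) _ (coe_chainTop _ _)
  have hbot := chainBotCoeff_of_eq_zsmul_add (α : Weight K H L) β hα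
    (chainTop (α : Weight K H L) β) _ (coe_chainTop _ _)
  simp only [cartanInt, Set.mem_insert_iff, Set.mem_singleton_iff, Prod.mk.injEq] at hmem
  omega

lemma lie_lie_lie_lie_eq_zero_of_mem_rootSpace (α : H.root) {e : L}
    (he : e ∈ rootSpace H (α : Weight K H L)) (x : L) : ⁅e, ⁅e, ⁅e, ⁅e, x⁆⁆⁆⁆ = 0 := by
  have hx : x ∈ (⨆ χ : Weight K H L, (rootSpace H χ).toSubmodule) := by
    rw [← LieSubmodule.iSup_toSubmodule, iSup_genWeightSpace_eq_top']
    trivial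
  induction hx using Submodule.iSup_induction' with
  | mem β x hx =>
    have h1 := lie_mem_genWeightSpace_of_mem_genWeightSpace he
      (lie_mem_genWeightSpace_of_mem_genWeightSpace he
        (lie_mem_genWeightSpace_of_mem_genWeightSpace he
          (lie_mem_genWeightSpace_of_mem_genWeightSpace he hx)))
    have hbot : rootSpace H ((4 : ℤ) • (α : Weight K H L) + β : H → K) = ⊥ := by
      by_contra hne
      have h2 := ((rootSpace_zsmul_add_ne_bot_iff _ β (H.isNonZero_coe_root α) 4).1 hne).1
      have h3 := chainTopCoeff_le_three α β
      lia
    have heq : ((α : Weight K H L) + ((α : Weight K H L) + ((α : Weight K H L) +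
        ((α : Weight K H L) + β))) : H → K) = (4 : ℤ) • (α : Weight K H L) + β := by
      module
    rw [heq] at h1
    have h2 : ⁅e, ⁅e, ⁅e, ⁅e, x⁆⁆⁆⁆ ∈ rootSpace H ((4 : ℤ) • (α : Weight K H L) + β : H → K) := h1
    rwa [hbot, LieSubmodule.mem_bot] at h2
  | zero => simp
  | add x y _ _ hx hy => simp only [lie_add, hx, hy, add_zero]

omit [CharZero K] in
/-- The coordinate functionals of a family of root vectors. -/
lemma exists_dual_apply_eq_one {e : H.root → L}
    (he : ∀ α : H.root, e α ∈ rootSpace H (α : Weight K H L)) (he0 : ∀ α, e α ≠ 0) :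
    ∃ φ : H.root → Dual K L, (∀ α, φ α (e α) = 1) ∧ (∀ α β, α ≠ β → φ α (e β) = 0) ∧
      ∀ α (x : H), φ α x = 0 := by
  have key (α : H.root) : ∃ φ : Dual K L, φ (e α) = 1 ∧ (∀ β, α ≠ β → φ (e β) = 0) ∧
      ∀ x : H, φ x = 0 := by
    -- The functional is Killing pairing with a vector of weight -α, which sees only the root space
    -- of α.
    obtain ⟨f, hfα, hf⟩ : ∃ f ∈ rootSpace H (-(α : Weight K H L)), killingForm K L (e α) f ≠ 0 := by
      by_contra! h
      have hker := mem_ker_killingForm_of_mem_rootSpace_of_forall_rootSpace_neg K L H (he α) h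
      exact he0 α (by simpa using hker)
    have hf' : killingForm K L f (e α) ≠ 0 := by rwa [LieModule.traceForm_comm]
    refine ⟨(killingForm K L f (e α))⁻¹ • killingForm K L f, by simp [hf'], fun β hβ ↦ ?_,
      fun x ↦ ?_⟩
    · rw [LinearMap.smul_apply, killingForm_apply_eq_zero_of_mem_rootSpace_of_add_ne_zero K L H hfα
        (he β), smul_zero]
      intro h
      refine hβ (Subtype.ext (DFunLike.coe_injective ?_))
      rw [neg_add_eq_zero] at h
      exact h
    · have hx : (x : L) ∈ rootSpace H (0 : H → K) := by
        rw [rootSpace_zero_eq K L H]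
        exact x.2
      rw [LinearMap.smul_apply, killingForm_apply_eq_zero_of_mem_rootSpace_of_add_ne_zero K L H hfα
        hx, smul_zero]
      intro h
      exact H.isNonZero_coe_root α (neg_eq_zero.1 ((add_zero _).symm.trans h))
  choose φ h1 h2 h3 using key
  exact ⟨φ, h1, h2, h3⟩

lemma exists_smul_eq_of_mem_rootSpace (α : H.root) {e x : L}
    (he : e ∈ rootSpace H (α : Weight K H L)) (he0 : e ≠ 0)
    (hx : x ∈ rootSpace H (α : Weight K H L)) : ∃ c : K, c • e = x := by
  have hne : (⟨e, he⟩ : rootSpace H (α : Weight K H L)) ≠ 0 :=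
    fun h ↦ he0 (congrArg Subtype.val h)
  obtain ⟨c, hc⟩ := (finrank_eq_one_iff_of_nonzero' _ hne).1
    (finrank_rootSpace_eq_one (α : Weight K H L) (H.isNonZero_coe_root α)) ⟨x, hx⟩
  exact ⟨c, congrArg Subtype.val hc⟩

lemma span_rootVector_union_coroot_eq_top {e : H.root → L}
    (he : ∀ α : H.root, e α ∈ rootSpace H (α : Weight K H L)) (he0 : ∀ α, e α ≠ 0) :
    Submodule.span K (Set.range e ∪
      Set.range fun α : H.root ↦ ((coroot (α : Weight K H L) : H) : L)) = ⊤ := by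
  rw [eq_top_iff]
  intro x _
  have hx : x ∈ (⨆ χ : Weight K H L, (rootSpace H χ).toSubmodule) := by
    rw [← LieSubmodule.iSup_toSubmodule, iSup_genWeightSpace_eq_top']
    trivial
  induction hx using Submodule.iSup_induction' with
  | mem β x hx =>
    by_cases hβ : β.IsZero
    · have hxH : x ∈ H := by
        rw [hβ.eq, rootSpace_zero_eq K L H] at hx
        exact hx
      have hspan : (⟨x, hxH⟩ : H) ∈ Submodule.span K (Set.range (rootSystem H).coroot) := by
        rw [RootPairing.IsRootSystem.span_coroot_eq_top]
        trivial
      have h := Submodule.mem_map_of_mem (f := H.toSubmodule.subtype) hspan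
      rw [Submodule.map_span] at h
      refine Submodule.span_mono ?_ h
      rintro _ ⟨_, ⟨α, rfl⟩, rfl⟩
      exact Or.inr ⟨α, rfl⟩
    · obtain ⟨γ, rfl⟩ : ∃ γ : H.root, β = γ := ⟨⟨β, by simpa using hβ⟩, rfl⟩
      obtain ⟨c, hcx⟩ := exists_smul_eq_of_mem_rootSpace γ (he γ) (he0 γ) hx
      rw [← hcx]
      exact Submodule.smul_mem _ _ (Submodule.subset_span (Or.inl ⟨γ, rfl⟩))
  | zero => exact zero_mem _
  | add x y _ _ hx hy => exact add_mem (hx trivial) (hy trivial)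

end LieAlgebra.IsKilling

/-! ### Root frames in characteristic zero -/

namespace LieAlgebra.IsKilling

open LieModule Module

/-- A split simple Lie algebra in characteristic zero has a root frame. -/
lemma nonempty_rootFrame {K L : Type*} [Field K] [CharZero K] [LieRing L] [LieAlgebra K L]
    [FiniteDimensional K L] [IsSimple K L] (H : LieSubalgebra K L) [H.IsCartanSubalgebra]
    [IsTriangularizable K H L] : Nonempty (RootFrame K L H.root) := by
  have hsl (α : H.root) := exists_isSl2Triple_of_weight_isNonZero (H.isNonZero_coe_root α)
  choose h e f ht he hf using hsl
  have hh (α : H.root) : h α = (coroot (α : Weight K H L) : H) :=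
    (ht α).h_eq_coroot (H.isNonZero_coe_root α) (he α) (hf α)
  have he0 (α : H.root) : e α ≠ 0 := (ht α).e_ne_zero
  obtain ⟨φ, h1, h2, h3⟩ := exists_dual_apply_eq_one he he0
  have : IsAddTorsionFree L := .of_isTorsionFree K L
  have h4 (α : H.root) := lie_lie_lie_lie_eq_zero_of_mem_rootSpace α (he α)
  exact ⟨{
    e := e
    f := f
    h := h
    c := fun α β ↦ cartanInt H α β
    coord := φ
    lie_h_e := fun α β ↦ by
      rw [cast_cartanInt, hh]
      exact lie_eq_smul_of_mem_rootSpace (he α) _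
    lie_h_h := fun α β ↦ by
      rw [hh, hh]
      exact congrArg (Subtype.val : H → L) (trivial_lie_zero H H _ _)
    lie_e_f := fun α ↦ (ht α).lie_e_f
    -- The sl₂-triples are chosen independently, so f α is only a multiple of the root vector for
    -- -α.
    f_mem := fun α ↦ by
      let γ : H.root := ⟨-α, by simpa using H.isNonZero_coe_root α⟩
      obtain ⟨c, hc⟩ := exists_smul_eq_of_mem_rootSpace γ (he γ) (he0 γ) (hf α)
      rw [← hc]
      exact Submodule.smul_mem _ _ (Submodule.subset_span ⟨γ, rfl⟩)
    span_eq_top := by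
      rw [funext hh]
      exact span_rootVector_union_coroot_eq_top he he0
    coord_e_self := h1
    coord_e_of_ne := h2
    coord_h := fun α β ↦ by rw [hh, h3]
    exists_c_ne := exists_cartanInt_cast_ne two_ne_zero three_ne_zero
    exists_c_ne_zero := fun α ↦ ⟨α, by simp [cartanInt_self]⟩
    connected := fun S hS hc ↦ eq_univ_of_forall_cartanInt_ne_zero S hS
      fun α hα β hβ ↦ hc α hα β (by simpa using hβ)
    lie_four := h4
    lie_two_three := fun α ↦ lie_lie_lie_lie_add_eq_zero (h4 α)
    lie_three_three := fun α ↦ lie_lie_lie_lie_eq_zero (h4 α) }⟩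

end LieAlgebra.IsKilling

/-! ### Reduction of a Chevalley basis -/

namespace ChevalleyBasis

open LieAlgebra LieAlgebra.IsKilling LieModule Module

variable {L : Type*} [LieRing L] [LieAlgebra ℂ L] [FiniteDimensional ℂ L] [IsKilling ℂ L]
  {H : LieSubalgebra ℂ L} [H.IsCartanSubalgebra] (C : ChevalleyBasis H)

lemma e_ne_zero (α : H.root) : C.e α ≠ 0 := by
  intro h
  have h1 := C.lie_e_neg α ⟨-α, by simpa using H.isNonZero_coe_root α⟩ rfl
  rw [h, zero_lie] at h1
  have h2 : coroot (α : Weight ℂ H L) = 0 := Subtype.ext h1.symm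
  exact H.isNonZero_coe_root α (coroot_eq_zero_iff.1 h2)

/-- The root vectors, as elements of the integral form. -/
noncomputable def eInt (α : H.root) : C.integralForm := ⟨C.e α, C.e_mem_span α⟩

/-- The coroots, as elements of the integral form. -/
noncomputable def hInt (α : H.root) : C.integralForm :=
  ⟨((coroot (α : Weight ℂ H L) : H) : L), C.coroot_mem_span α⟩

lemma span_eInt_union_hInt : Submodule.span ℤ (Set.range C.eInt ∪ Set.range C.hInt) = ⊤ := by
  rw [Submodule.eq_top_iff']
  rintro ⟨x, hx⟩
  change x ∈ Submodule.span ℤ C.toSet at hx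
  induction hx using Submodule.span_induction with
  | mem x hx =>
    rcases hx with ⟨α, rfl⟩ | ⟨α, -, rfl⟩
    · exact Submodule.subset_span (Or.inl ⟨α, rfl⟩)
    · exact Submodule.subset_span (Or.inr ⟨α, rfl⟩)
  | zero => exact zero_mem _
  | add x y hx hy h1 h2 => exact add_mem h1 h2
  | smul a x hx h => exact Submodule.smul_mem _ a h

/-- The coordinate functionals of the root vectors take integral values on the integral form. -/
lemma exists_dual_int : ∃ φ : H.root → Dual ℤ C.integralForm, (∀ α, φ α (C.eInt α) = 1) ∧
    (∀ α β, α ≠ β → φ α (C.eInt β) = 0) ∧ ∀ α β, φ α (C.hInt β) = 0 := by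
  obtain ⟨φ, h1, h2, h3⟩ := exists_dual_apply_eq_one C.e_mem C.e_ne_zero
  -- Integrality is what lets the coordinates be base changed to F; it is checked on the spanning
  -- set, where they take the values 0 and 1.
  have hint (α : H.root) (x : C.integralForm) : ∃ n : ℤ, (n : ℂ) = φ α x := by
    have hx : x ∈ Submodule.span ℤ (Set.range C.eInt ∪ Set.range C.hInt) :=
      C.span_eInt_union_hInt ▸ Submodule.mem_top
    induction hx using Submodule.span_induction with
    | mem x hx =>
      rcases hx with ⟨β, rfl⟩ | ⟨β, rfl⟩
      · by_cases h : α = β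
        · exact ⟨1, by subst h; exact Int.cast_one.trans (h1 α).symm⟩
        · exact ⟨0, Int.cast_zero.trans (h2 α β h).symm⟩
      · exact ⟨0, Int.cast_zero.trans (h3 α _).symm⟩
    | zero => exact ⟨0, by simp⟩
    | add x y _ _ hx hy =>
      obtain ⟨m, hm⟩ := hx
      obtain ⟨n, hn⟩ := hy
      exact ⟨m + n, by push_cast; rw [hm, hn, ← map_add]⟩
    | smul a x _ hx =>
      obtain ⟨n, hn⟩ := hx
      exact ⟨a * n, by push_cast; rw [hn, ← zsmul_eq_mul, ← map_zsmul]⟩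
  choose ψ hψ using hint
  refine ⟨fun α ↦ (AddMonoidHom.mk' (ψ α) fun x y ↦ ?_).toIntLinearMap, fun α ↦ ?_,
    fun α β hαβ ↦ ?_, fun α β ↦ ?_⟩
  · apply Int.cast_injective (α := ℂ)
    push_cast
    rw [hψ, hψ, hψ, ← map_add]
    rfl
  · apply Int.cast_injective (α := ℂ)
    exact (hψ _ _).trans ((h1 α).trans Int.cast_one.symm)
  · apply Int.cast_injective (α := ℂ)
    exact (hψ _ _).trans ((h2 α β hαβ).trans Int.cast_zero.symm)
  · apply Int.cast_injective (α := ℂ)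
    exact (hψ _ _).trans ((h3 α _).trans Int.cast_zero.symm)

lemma lie_hInt_eInt (α β : H.root) : ⁅C.hInt β, C.eInt α⁆ = cartanInt H α β • C.eInt α := by
  apply Subtype.ext
  have h : ⁅coroot (β : Weight ℂ H L), C.e α⁆ =
      (α : Weight ℂ H L) (coroot (β : Weight ℂ H L)) • C.e α :=
    lie_eq_smul_of_mem_rootSpace (C.e_mem α) _
  rw [← cast_cartanInt, Int.cast_smul_eq_zsmul] at h
  exact h

lemma lie_hInt_hInt (α β : H.root) : ⁅C.hInt α, C.hInt β⁆ = 0 :=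
  Subtype.ext (congrArg (Subtype.val : H → L) (trivial_lie_zero H H _ _))

lemma lie_eInt_four (α : H.root) (x : C.integralForm) :
    ⁅C.eInt α, ⁅C.eInt α, ⁅C.eInt α, ⁅C.eInt α, x⁆⁆⁆⁆ = 0 :=
  Subtype.ext (lie_lie_lie_lie_eq_zero_of_mem_rootSpace α (C.e_mem α) x)

/-- The reduction of a Chevalley basis is a root frame if `2` and `3` are invertible. -/
lemma nonempty_rootFrame [(rootSystem H).IsIrreducible] {F : Type*} [Field F]
    (h2 : (2 : F) ≠ 0) (h3 : (3 : F) ≠ 0) : Nonempty (RootFrame F (C.overField F) H.root) := by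
  obtain ⟨φ, hφ1, hφ2, hφ3⟩ := C.exists_dual_int
  have : IsAddTorsionFree L := .of_isTorsionFree ℂ L
  have : IsAddTorsionFree C.integralForm :=
    Function.Injective.isAddTorsionFree C.integralForm.toSubmodule.subtype.toAddMonoidHom
      Subtype.val_injective
  let ν (α : H.root) : H.root := ⟨-α, by simpa using H.isNonZero_coe_root α⟩
  exact ⟨{
    e := fun α ↦ 1 ⊗ₜ C.eInt α
    f := fun α ↦ 1 ⊗ₜ C.eInt (ν α)
    h := fun α ↦ 1 ⊗ₜ C.hInt α
    c := fun α β ↦ cartanInt H α β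
    coord := fun α ↦ (φ α).baseChange F
    lie_h_e := fun α β ↦ by
      rw [LieAlgebra.ExtendScalars.bracket_tmul, lie_hInt_eInt, one_mul, TensorProduct.tmul_smul,
        Int.cast_smul_eq_zsmul]
    lie_h_h := fun α β ↦ by
      rw [LieAlgebra.ExtendScalars.bracket_tmul, lie_hInt_hInt, TensorProduct.tmul_zero]
    lie_e_f := fun α ↦ by
      have h : ⁅C.eInt α, C.eInt (ν α)⁆ = C.hInt α := Subtype.ext (C.lie_e_neg α (ν α) rfl)
      rw [LieAlgebra.ExtendScalars.bracket_tmul, h, one_mul]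
    f_mem := fun α ↦ Submodule.subset_span ⟨ν α, rfl⟩
    span_eq_top := by
      have h := congrArg (Submodule.baseChange F) C.span_eInt_union_hInt
      rw [Submodule.baseChange_span, Submodule.baseChange_top, Set.image_union, ← Set.range_comp,
        ← Set.range_comp] at h
      exact h
    coord_e_self := fun α ↦ by simp [hφ1]
    coord_e_of_ne := fun α β h ↦ by simp [hφ2 α β h]
    coord_h := fun α β ↦ by simp [hφ3]
    exists_c_ne := exists_cartanInt_cast_ne h2 h3
    exists_c_ne_zero := fun α ↦ ⟨α, by simpa [cartanInt_self] using h2⟩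
    connected := fun S hS hc ↦ eq_univ_of_forall_cartanInt_ne_zero S hS
      fun α hα β hβ ↦ hc α hα β (cartanInt_cast_ne_zero h2 h3 hβ)
    lie_four := fun α x ↦ by
      induction x using TensorProduct.induction_on with
      | zero => simp
      | tmul a x =>
        simp only [LieAlgebra.ExtendScalars.bracket_tmul, lie_eInt_four, TensorProduct.tmul_zero]
      | add x y hx hy => simp only [lie_add, hx, hy, add_zero]
    -- By biadditivity pure tensors suffice; there the identity comes from the torsion-free integral
    -- form, where division by 10 is legitimate.
    lie_two_three := fun α x y ↦ by
      induction x using TensorProduct.induction_on with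
      | zero => simp
      | tmul a x =>
        induction y using TensorProduct.induction_on with
        | zero => simp
        | tmul b y =>
          simp only [LieAlgebra.ExtendScalars.bracket_tmul, ← TensorProduct.tmul_add, one_mul,
            lie_lie_lie_lie_add_eq_zero (C.lie_eInt_four α), TensorProduct.tmul_zero]
        | add y z hy hz =>
          simp only [lie_add]
          rw [add_add_add_comm, hy, hz, add_zero]
      | add x z hx hz =>
        simp only [lie_add, add_lie]
        rw [add_add_add_comm, hx, hz, add_zero]
    lie_three_three := fun α x y ↦ by
      induction x using TensorProduct.induction_on with
      | zero => simp
      | tmul a x =>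
        induction y using TensorProduct.induction_on with
        | zero => simp
        | tmul b y =>
          simp only [LieAlgebra.ExtendScalars.bracket_tmul,
            lie_lie_lie_lie_eq_zero (C.lie_eInt_four α), TensorProduct.tmul_zero]
        | add y z hy hz => simp only [lie_add, hy, hz, add_zero]
      | add x z hx hz => simp only [lie_add, add_lie, hx, hz, add_zero] }⟩

end ChevalleyBasis

/-! ### Passage to the central quotient and the theorem -/

lemma IsGeneratedByOneAndHalf.of_lieEquiv {F L L' : Type*} [Field F] [LieRing L] [LieAlgebra F L]
    [LieRing L'] [LieAlgebra F L'] (h : IsGeneratedByOneAndHalf F L) (φ : L ≃ₗ⁅F⁆ L') :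
    IsGeneratedByOneAndHalf F L' := by
  intro x hx
  obtain ⟨y, hy⟩ := h (φ.symm x) fun h0 ↦ hx (by simpa using congrArg φ h0)
  refine ⟨φ y, ?_⟩
  have h1 := congrArg (LieSubalgebra.map φ.toLieHom) hy
  rw [LieSubalgebra.map_lieSpan, Set.image_pair, ← LieHom.range_eq_map,
    (LieHom.range_eq_top _).2 φ.surjective] at h1
  simpa using h1

/-- A Lie algebra with a root frame is, modulo its centre, generated by one and a half elements. -/
lemma RootFrame.isGeneratedByOneAndHalf_quotient_center {F A ι : Type*} [Field F] [Infinite F]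
    [Finite ι] [LieRing A] [LieAlgebra F A] (R : RootFrame F A ι) (h6 : (6 : F) ≠ 0) :
    IsGeneratedByOneAndHalf F (A ⧸ LieAlgebra.center F A) := by
  intro x hx
  obtain ⟨x, rfl⟩ := LieSubmodule.Quotient.surjective_mk' _ x
  -- A nonzero class modulo the centre has a noncentral lift, and the image of a generating pair
  -- generates the quotient.
  have hx' : ∃ y : A, ⁅y, x⁆ ≠ 0 := by
    by_contra! h
    refine hx (LieSubmodule.Quotient.mk_eq_zero'.2 ?_)
    exact (LieModule.mem_maxTrivSubmodule _ _ _ x).2 h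
  obtain ⟨y, hy⟩ := R.exists_lieSpan_eq_top h6 hx'
  let π : A →ₗ⁅F⁆ A ⧸ LieAlgebra.center F A :=
    { LieSubmodule.Quotient.mk' (LieAlgebra.center F A) with
      map_lie' := fun {a b} ↦ LieSubmodule.Quotient.mk_bracket _ a b }
  refine ⟨π y, ?_⟩
  have h1 := congrArg (LieSubalgebra.map π) hy
  rw [LieSubalgebra.map_lieSpan, Set.image_pair, ← LieHom.range_eq_map,
    (LieHom.range_eq_top _).2 (LieSubmodule.Quotient.surjective_mk' _)] at h1
  exact h1

theorem mainTheorem2 {F : Type*} [Field F] [IsAlgClosed F] (p : ℕ) [CharP F p]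
    (hp : p = 0 ∨ 3 < p) {𝔤 : Type*} [LieRing 𝔤] [LieAlgebra F 𝔤] :
    (IsClassicalSimple F 𝔤 → IsGeneratedByOneAndHalf F 𝔤) ∧
    (p = 0 → FiniteDimensional F 𝔤 → LieAlgebra.IsSimple F 𝔤 → IsGeneratedByOneAndHalf F 𝔤) := by
  have : Infinite F := IsAlgClosed.instInfinite
  have hcast (n : ℕ) (h0 : n ≠ 0) (hn : n ≤ 3) : (n : F) ≠ 0 := by
    rw [Ne, CharP.cast_eq_zero_iff F p]
    intro h
    rcases hp with rfl | hp
    · exact h0 (zero_dvd_iff.1 h)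
    · have := Nat.le_of_dvd (Nat.pos_of_ne_zero h0) h
      lia
  have h2 : (2 : F) ≠ 0 := hcast 2 (by simp) (by simp)
  have h3 : (3 : F) ≠ 0 := hcast 3 (by simp) (by simp)
  have h6 : (6 : F) ≠ 0 := by
    convert mul_ne_zero h2 h3 using 1
    norm_num
  constructor
  · rintro ⟨L, _, _, _, _, H, _, C, ⟨φ⟩⟩
    obtain ⟨R⟩ := C.nonempty_rootFrame h2 h3
    exact (R.isGeneratedByOneAndHalf_quotient_center h6).of_lieEquiv φ.symm
  · rintro rfl _ _ x hx
    have := CharP.charP_to_charZero F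
    obtain ⟨a, ha⟩ := LieAlgebra.exists_isCartanSubalgebra_engel F 𝔤
    obtain ⟨R⟩ := LieAlgebra.IsKilling.nonempty_rootFrame (LieSubalgebra.engel F a)
    refine R.exists_lieSpan_eq_top h6 ?_
    by_contra! h
    have hc : x ∈ LieAlgebra.center F 𝔤 := (LieModule.mem_maxTrivSubmodule _ _ _ x).2 h
    rw [LieAlgebra.center_eq_bot, LieSubmodule.mem_bot] at hc
    exact hx hc
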